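/- Let $\mathbb{M}^2$ be the space of real $2\times 2$ matrices with the Euclidean norm $|A|=(\sum_{i,j}A_{ij}^2)^{1/2}$, let $\operatorname{cof}A$ be the cofactor matrix of $A$, and let $\kappa\ge 0$. Let $A\in C^0(\mathbb{R},\mathrm{SL}(2,\mathbb{R}))\cap C^2(\mathbb{R},\mathbb{M}^2)$ be a solution of $$\ddot A(t)+\kappa A(t)=\lambda(t)\operatorname{cof}A(t),\qquad t\in\mathbb{R},$$ for some $\lambda\in C^0(\mathbb{R},\mathbb{R})$. (i) Suppose that $|A|$ is nonconstant and $T$-periodic for some $T>0$. Then for every integer $N\ge 1$ there exists $\ell\in\{1,\dots,N^2\}$ such that $$|A(2\ell T+t)-A(t)|\le \frac{8\pi\,|A(t)|}{N}\qquad\text{for all } t\in\mathbb{R}.$$ In particular $A$ is recurrent: for all $\varepsilon>0$ and $S\in\mathbb{R}$ there is $\tau>S$ such that $|A(\tau+t)-A(t)|<\varepsilon$ for all $t\in\mathbb{R}$. (ii) Suppose that $A$ is rigid, that is, $|A(t)|$ is constant in $t\in\mathbb{R}$. Then either $A$ is periodic (there is $P>0$ with $A(t+P)=A(t)$ for all $t$;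 constant solutions are included), or the range of $A$ is a dense subset of the sphere $\{B\in\mathrm{SL}(2,\mathbb{R}) : |B|=|A(0)|\}$ of radius $|A(0)|$ in $\mathrm{SL}(2,\mathbb{R})$ (or both). -/

import Mathlib

attribute [local instance] Matrix.frobeniusNormedAddCommGroup

namespace AffineMHD

/-- The space of real `2 × 2` matrices. With the local instance above its norm is the Euclidean
(Frobenius) norm `|A| = (∑ i, ∑ j, A i j ^ 2) ^ (1 / 2)`. -/
abbrev M2 : Type := Matrix (Fin 2) (Fin 2) ℝ

/-- The cofactor matrix, that is, the transpose of the adjugate. -/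
def cof (A : M2) : M2 := A.adjugate.transpose

/-- `A` is a global solution, in `C⁰(ℝ, SL(2, ℝ)) ∩ C²(ℝ, M2)`, of the equation of affine motion
`A'' + κ A = lam cof A` with some continuous scalar function `lam` (the Lagrange multiplier).
Smoothness and time derivatives of the matrix-valued curve are written entry by entry. -/
structure IsSolution (κ : ℝ) (A : ℝ → M2) : Prop where
  contDiff : ∀ i j : Fin 2, ContDiff ℝ 2 (fun t : ℝ => A t i j)
  det_eq_one : ∀ t : ℝ, (A t).det = 1
  exists_multiplier : ∃ lam : ℝ → ℝ, Continuous lam ∧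
    ∀ (t : ℝ) (i j : Fin 2),
      deriv (deriv (fun s : ℝ => A s i j)) t + κ * A t i j = lam t * cof (A t) i j

/-- A curve is rigid if its norm is constant in time. -/
def IsRigid (A : ℝ → M2) : Prop := ∃ c : ℝ, ∀ t : ℝ, ‖A t‖ = c

/-- The curve returns, uniformly in time, arbitrarily close to itself after arbitrarily long
delays. -/
def IsRecurrent (A : ℝ → M2) : Prop :=
  ∀ ε : ℝ, 0 < ε → ∀ S : ℝ, ∃ τ : ℝ, S < τ ∧ ∀ t : ℝ, ‖A (τ + t) - A t‖ < ε

/-- The sphere of radius `r` in `SL(2, ℝ)`. -/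
def slSphere (r : ℝ) : Set M2 := {B : M2 | B.det = 1 ∧ ‖B‖ = r}

end AffineMHD

/-! Write `A z = α z + β (conj z)` with `α, β` complex. Then `|A|² = 2(|α|² + |β|²)` and `det A =
|α|² - |β|²`, while `cof` fixes `α` and negates `β`. The equation splits into two planar central
motions, `α'' = (lam - κ) α` and `β'' = (-lam - κ) β`, and `det A = 1` makes both radii functions of
`|A|`.

If `|A|` has period `T`, radius and conserved angular momentum determine `conj z * z'`, which
therefore has period `T`. As `α` never vanishes, so does `lam`. Uniqueness for the linear equation
then makes the shift by `T` act on `(α, β)` as a pair of rotations (`IsSolution.exists_rotations`),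
and Dirichlet's pigeonhole argument brings some power of that pair close to the identity
(`exists_pow_near_one`).

If `|A|` is constant, both parts rotate uniformly and the sphere is a torus on which `A` draws a
straight line, periodic or dense according to the frequency ratio (`exists_exp_near`). -/

namespace AffineMHD

open Complex ComplexConjugate

/-! ### The conformal and anticonformal parts of a matrix -/

/-- The complex number `α` in the decomposition `A z = α z + β (conj z)`. -/
noncomputable def conf (A : M2) : ℂ := ⟨(A 0 0 + A 1 1) / 2, (A 1 0 - A 0 1) / 2⟩

/-- The complex number `β` in the decomposition `A z = α z + β (conj z)`. -/
noncomputable def anti (A : M2) : ℂ := ⟨(A 0 0 - A 1 1) / 2, (A 0 1 + A 1 0) / 2⟩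

lemma norm_sq_eq_sum (A : M2) :
    ‖A‖ ^ 2 = A 0 0 ^ 2 + A 0 1 ^ 2 + (A 1 0 ^ 2 + A 1 1 ^ 2) := by
  have h : 0 ≤ A 0 0 ^ 2 + A 0 1 ^ 2 + (A 1 0 ^ 2 + A 1 1 ^ 2) := by positivity
  rw [Matrix.frobenius_norm_def, ← Real.sqrt_eq_rpow]
  simp only [Fin.sum_univ_two, Real.rpow_two, Real.norm_eq_abs, sq_abs]
  exact Real.sq_sqrt h

lemma norm_sq_conf (A : M2) :
    ‖conf A‖ ^ 2 = ((A 0 0 + A 1 1) ^ 2 + (A 1 0 - A 0 1) ^ 2) / 4 := by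
  rw [← Complex.normSq_eq_norm_sq, Complex.normSq_apply, conf]
  ring

lemma norm_sq_anti (A : M2) :
    ‖anti A‖ ^ 2 = ((A 0 0 - A 1 1) ^ 2 + (A 0 1 + A 1 0) ^ 2) / 4 := by
  rw [← Complex.normSq_eq_norm_sq, Complex.normSq_apply, anti]
  ring

lemma norm_sq_eq (A : M2) : ‖A‖ ^ 2 = 2 * (‖conf A‖ ^ 2 + ‖anti A‖ ^ 2) := by
  rw [norm_sq_eq_sum, norm_sq_conf, norm_sq_anti]
  ring

lemma det_eq (A : M2) : A.det = ‖conf A‖ ^ 2 - ‖anti A‖ ^ 2 := by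
  rw [Matrix.det_fin_two, norm_sq_conf, norm_sq_anti]
  ring

lemma conf_sub (A B : M2) : conf (A - B) = conf A - conf B := by
  apply Complex.ext <;> simp [conf] <;> ring

lemma anti_sub (A B : M2) : anti (A - B) = anti A - anti B := by
  apply Complex.ext <;> simp [anti] <;> ring

lemma norm_sq_conf_of_det_eq_one {A : M2} (h : A.det = 1) :
    ‖conf A‖ ^ 2 = (‖A‖ ^ 2 + 2) / 4 := by
  rw [det_eq] at h
  rw [norm_sq_eq]
  linarith

lemma norm_sq_anti_of_det_eq_one {A : M2} (h : A.det = 1) :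
    ‖anti A‖ ^ 2 = (‖A‖ ^ 2 - 2) / 4 := by
  rw [det_eq] at h
  rw [norm_sq_eq]
  linarith

lemma conf_ne_zero {A : M2} (h : A.det = 1) : conf A ≠ 0 := by
  intro h0
  have := norm_sq_conf_of_det_eq_one h
  rw [h0, norm_zero] at this
  nlinarith [sq_nonneg ‖A‖]

lemma norm_conf_eq {A B : M2} (hA : A.det = 1) (hB : B.det = 1) (h : ‖A‖ = ‖B‖) :
    ‖conf A‖ = ‖conf B‖ := by
  rw [← sq_eq_sq₀ (norm_nonneg _) (norm_nonneg _), norm_sq_conf_of_det_eq_one hA,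
    norm_sq_conf_of_det_eq_one hB, h]

lemma norm_anti_eq {A B : M2} (hA : A.det = 1) (hB : B.det = 1) (h : ‖A‖ = ‖B‖) :
    ‖anti A‖ = ‖anti B‖ := by
  rw [← sq_eq_sq₀ (norm_nonneg _) (norm_nonneg _), norm_sq_anti_of_det_eq_one hA,
    norm_sq_anti_of_det_eq_one hB, h]

/-- Multiplying both parts of a matrix by complex numbers close to `1` moves it little. -/
lemma norm_sub_le_of_mul {A B : M2} {u v : ℂ} {δ : ℝ} (hδ : 0 ≤ δ)
    (hc : conf B = u * conf A) (ha : anti B = v * anti A)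
    (hu : ‖u - 1‖ ≤ δ) (hv : ‖v - 1‖ ≤ δ) : ‖B - A‖ ≤ δ * ‖A‖ := by
  rw [← sq_le_sq₀ (norm_nonneg _) (by positivity), mul_pow, norm_sq_eq, norm_sq_eq A, conf_sub,
    anti_sub, hc, ha, ← sub_one_mul, ← sub_one_mul, norm_mul, norm_mul, mul_pow, mul_pow]
  have h1 : ‖u - 1‖ ^ 2 ≤ δ ^ 2 := by gcongr
  have h2 : ‖v - 1‖ ^ 2 ≤ δ ^ 2 := by gcongr
  nlinarith [mul_le_mul_of_nonneg_right h1 (sq_nonneg ‖conf A‖),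
    mul_le_mul_of_nonneg_right h2 (sq_nonneg ‖anti A‖)]

lemma eq_of_conf_anti {A B : M2} (hc : conf B = conf A) (ha : anti B = anti A) : B = A := by
  have h := norm_sub_le_of_mul (A := A) (B := B) (u := 1) (v := 1) le_rfl (by simpa using hc)
    (by simpa using ha) (by simp) (by simp)
  rw [zero_mul] at h
  exact sub_eq_zero.1 (norm_le_zero_iff.1 h)

/-! ### Motion in a central force field -/

/-- `z : ℝ → ℂ` has velocity `w` and solves `z'' = q z` with a real coefficient `q`. -/
structure IsCentral (q : ℝ → ℝ) (z w : ℝ → ℂ) : Prop where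
  hasDerivAt : ∀ t, HasDerivAt z (w t) t
  hasDerivAt_vel : ∀ t, HasDerivAt w (q t * z t) t

lemma hasDerivAt_conj {z : ℝ → ℂ} {z' : ℂ} {t : ℝ} (h : HasDerivAt z z' t) :
    HasDerivAt (fun s => conj (z s)) (conj z') t :=
  h.star

namespace IsCentral

variable {q : ℝ → ℝ} {z w : ℝ → ℂ}

/-- The derivative is real because `q` is. This yields conservation of angular momentum and later
lets `q` be recovered from the motion. -/
lemma hasDerivAt_conj_mul (h : IsCentral q z w) (t : ℝ) :
    HasDerivAt (fun s => conj (z s) * w s)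
      ((‖w t‖ ^ 2 + q t * ‖z t‖ ^ 2 : ℝ) : ℂ) t := by
  refine ((hasDerivAt_conj (h.hasDerivAt t)).mul (h.hasDerivAt_vel t)).congr_deriv ?_
  push_cast
  rw [← Complex.conj_mul', ← Complex.conj_mul']
  ring

/-- Conservation of angular momentum. -/
lemma im_conj_mul_eq (h : IsCentral q z w) (s t : ℝ) :
    (conj (z s) * w s).im = (conj (z t) * w t).im := by
  have hd : ∀ t, HasDerivAt (fun s => (conj (z s) * w s).im) 0 t := fun t => by
    exact (Complex.imCLM.hasFDerivAt.comp_hasDerivAt t (h.hasDerivAt_conj_mul t)).congr_deriv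
      (Complex.ofReal_im (‖w t‖ ^ 2 + q t * ‖z t‖ ^ 2))
  exact is_const_of_deriv_eq_zero (fun t => (hd t).differentiableAt) (fun t => (hd t).deriv) s t

lemma hasDerivAt_norm_sq (h : IsCentral q z w) (t : ℝ) :
    HasDerivAt (fun s => ‖z s‖ ^ 2) (2 * (conj (z t) * w t).re) t := by
  refine (h.hasDerivAt t).norm_sq.congr_deriv ?_
  rw [Complex.inner]
  ring_nf

/-- The real part is half the derivative of `‖z‖ ^ 2`; the imaginary part is the angular momentum.
-/
lemma conj_mul_add (h : IsCentral q z w) {T : ℝ} (hT : ∀ t, ‖z (t + T)‖ = ‖z t‖) (t : ℝ) :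
    conj (z (t + T)) * w (t + T) = conj (z t) * w t := by
  apply Complex.ext
  · have h1 := (h.hasDerivAt_norm_sq (t + T)).comp_add_const t T
    simp only [hT] at h1
    have := h1.unique (h.hasDerivAt_norm_sq t)
    linarith
  · exact h.im_conj_mul_eq _ _

/-- Differentiating `conj z * w` shows that `‖w‖ ^ 2 + q * ‖z‖ ^ 2` repeats; where `z ≠ 0`, the
modulus of `conj z * w` gives `‖w‖`, so `q` can be solved for. -/
lemma coeff_add (h : IsCentral q z w) {T : ℝ} (hT : ∀ t, ‖z (t + T)‖ = ‖z t‖) {t : ℝ}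
    (ht : z t ≠ 0) : q (t + T) = q t := by
  have h1 := (h.hasDerivAt_conj_mul (t + T)).comp_add_const t T
  simp only [h.conj_mul_add hT] at h1
  have h2 := Complex.ofReal_injective (h1.unique (h.hasDerivAt_conj_mul t))
  have h3 := congrArg norm (h.conj_mul_add hT t)
  have hz : ‖z t‖ ≠ 0 := norm_ne_zero_iff.2 ht
  simp only [norm_mul, RCLike.norm_conj, hT] at h2 h3
  have h4 := mul_left_cancel₀ hz h3
  rw [h4] at h2
  exact mul_right_cancel₀ (pow_ne_zero 2 hz) (add_left_cancel h2)

/-- Uniqueness for the Cauchy problem with zero data. -/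
lemma eq_zero (h : IsCentral q z w) (hq : Continuous q) {t₀ : ℝ} (hz : z t₀ = 0)
    (hw : w t₀ = 0) (t : ℝ) : z t = 0 := by
  -- Grönwall: `|E'| ≤ (1 + |q|) E`, so with `Q' = 1 + |q|`, `E * exp (-Q)` decreases (used after
  -- `t₀`) and `E * exp Q` increases (used before `t₀`).
  set E : ℝ → ℝ := fun s => ‖z s‖ ^ 2 + ‖w s‖ ^ 2 with hE
  have hE' : ∀ s, HasDerivAt E (2 * inner ℝ (z s) (w s) + 2 * inner ℝ (w s) (q s * z s)) s :=
    fun s => (h.hasDerivAt s).norm_sq.add (h.hasDerivAt_vel s).norm_sq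
  set Q : ℝ → ℝ := fun s => ∫ x in t₀..s, (1 + |q x|) with hQ
  have hQ' : ∀ s, HasDerivAt Q (1 + |q s|) s := fun s =>
    (continuous_const.add hq.abs).integral_hasStrictDerivAt t₀ s |>.hasDerivAt
  have hbound : ∀ s, |2 * inner ℝ (z s) (w s) + 2 * inner ℝ (w s) (q s * z s)| ≤
      (1 + |q s|) * E s := fun s => by
    have h1 := abs_real_inner_le_norm (z s) (w s)
    have h2 := abs_real_inner_le_norm (w s) (q s * z s)
    rw [norm_mul, Complex.norm_real, Real.norm_eq_abs] at h2
    have h3 := abs_add_le (2 * inner ℝ (z s) (w s)) (2 * inner ℝ (w s) (q s * z s))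
    rw [abs_mul, abs_mul, abs_two] at h3
    have h4 := mul_nonneg (add_nonneg zero_le_one (abs_nonneg (q s)))
      (sq_nonneg (‖z s‖ - ‖w s‖))
    simp only [hE]
    nlinarith
  have hE0 : E t₀ = 0 := by simp [hE, hz, hw]
  have hEt : E t ≤ 0 := by
    rcases le_total t₀ t with hle | hle
    · have hd : ∀ s, HasDerivAt (fun s => E s * Real.exp (-Q s)) _ s := fun s =>
        (hE' s).mul (hQ' s).neg.exp
      have hanti : Antitone fun s => E s * Real.exp (-Q s) := by
        refine antitone_of_deriv_nonpos (fun s => (hd s).differentiableAt) fun s => ?_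
        rw [(hd s).deriv, Pi.neg_apply]
        linarith [mul_le_mul_of_nonneg_right ((le_abs_self _).trans (hbound s))
          (Real.exp_pos (-Q s)).le]
      have := hanti hle
      simp only [hE0, zero_mul] at this
      exact nonpos_of_mul_nonpos_left this (Real.exp_pos _)
    · have hd : ∀ s, HasDerivAt (fun s => E s * Real.exp (Q s)) _ s := fun s =>
        (hE' s).mul (hQ' s).exp
      have hmono : Monotone fun s => E s * Real.exp (Q s) := by
        refine monotone_of_deriv_nonneg (fun s => (hd s).differentiableAt) fun s => ?_
        rw [(hd s).deriv]
        linarith [mul_le_mul_of_nonneg_right (abs_le.1 (hbound s)).1 (Real.exp_pos (Q s)).le]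
      have := hmono hle
      simp only [hE0, zero_mul] at this
      exact nonpos_of_mul_nonpos_left this (Real.exp_pos _)
  have : ‖z t‖ ^ 2 ≤ 0 := by
    have := sq_nonneg ‖w t‖
    simp only [hE] at hEt
    linarith
  simpa using le_antisymm this (sq_nonneg _)

/-- If the coefficient and the distance to the origin are `T`-periodic, then the motion is
`T`-periodic up to a rotation. -/
lemma exists_rotation (h : IsCentral q z w) (hq : Continuous q) {T : ℝ}
    (hqT : ∀ t, q (t + T) = q t) (hT : ∀ t, ‖z (t + T)‖ = ‖z t‖) :
    ∃ c : ℂ, ‖c‖ = 1 ∧ ∀ t, z (t + T) = c * z t := by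
  by_cases h0 : ∀ t, z t = 0
  · exact ⟨1, norm_one, fun t => by simp [h0]⟩
  push Not at h0
  obtain ⟨t₀, ht₀⟩ := h0
  have hn : ‖z t₀‖ ≠ 0 := norm_ne_zero_iff.2 ht₀
  -- The rotation is read off at one time where `z ≠ 0`. The difference `z (t + T) - c * z t` solves
  -- the same equation with zero data at `t₀`, so zeros of `z` elsewhere do no harm.
  set c : ℂ := z (t₀ + T) / z t₀ with hc
  have hcz : z (t₀ + T) = c * z t₀ := (div_mul_cancel₀ _ ht₀).symm
  have hc1 : ‖c‖ = 1 := by rw [hc, norm_div, hT, div_self hn]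
  have hδ : IsCentral q (fun t => z (t + T) - c * z t) (fun t => w (t + T) - c * w t) := by
    refine ⟨fun t => ((h.hasDerivAt (t + T)).comp_add_const t T).sub
      ((h.hasDerivAt t).const_mul c), fun t => ?_⟩
    refine (((h.hasDerivAt_vel (t + T)).comp_add_const t T).sub
      ((h.hasDerivAt_vel t).const_mul c)).congr_deriv ?_
    rw [hqT]
    ring
  refine ⟨c, hc1, fun t => sub_eq_zero.1 (hδ.eq_zero hq (t₀ := t₀) ?_ ?_ t)⟩
  · simp [hcz]
  · have h1 := h.conj_mul_add hT t₀
    have h2 : conj c * c = 1 := by rw [Complex.conj_mul', hc1]; simp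
    rw [hcz, map_mul] at h1
    have h3 : conj c ≠ 0 := left_ne_zero_of_mul_eq_one h2
    have h4 : conj (z t₀) ≠ 0 := by simpa using ht₀
    refine mul_left_cancel₀ (mul_ne_zero h3 h4) ?_
    rw [mul_zero]
    linear_combination h1 - conj (z t₀) * w t₀ * h2

/-- A central motion at constant distance from the origin is a uniform rotation. -/
lemma exists_eq_exp (h : IsCentral q z w) (hz : ∀ t, ‖z t‖ = ‖z 0‖) :
    ∃ ω : ℝ, ∀ t : ℝ, z t = exp ((ω * t : ℝ) * I) * z 0 := by
  by_cases h0 : z 0 = 0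
  · refine ⟨0, fun t => ?_⟩
    have := hz t
    rw [h0, norm_zero, norm_eq_zero] at this
    simp [this, h0]
  have hn : ‖z 0‖ ≠ 0 := norm_ne_zero_iff.2 h0
  have hne : ∀ t, z t ≠ 0 := fun t => by rw [← norm_ne_zero_iff, hz]; exact hn
  set L : ℝ := (conj (z 0) * w 0).im with hL
  -- Constant radius kills the real part, leaving the angular momentum; hence `w = ω * I * z`.
  have hf : ∀ t, conj (z t) * w t = L * I := fun t => by
    apply Complex.ext
    · have h1 := h.hasDerivAt_norm_sq t
      simp only [hz] at h1
      have := h1.unique (hasDerivAt_const t _)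
      simp only [mul_re, ofReal_re, I_re, ofReal_im, I_im] at this ⊢
      linarith
    · rw [h.im_conj_mul_eq t 0, ← hL]
      simp
  set ω : ℝ := L / ‖z 0‖ ^ 2 with hω
  have hw : ∀ t, w t = ω * I * z t := fun t => by
    have h4 : conj (z t) ≠ 0 := by simpa using hne t
    refine mul_left_cancel₀ h4 ?_
    have hL' : (L : ℂ) = ω * (‖z t‖ : ℂ) ^ 2 := by
      rw [hz t, hω]
      push_cast
      rw [div_mul_cancel₀ _ (pow_ne_zero 2 (by exact_mod_cast hn))]
    rw [hf, hL', ← Complex.conj_mul']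
    ring
  refine ⟨ω, fun t => ?_⟩
  have hd : ∀ t : ℝ, HasDerivAt (fun s : ℝ => exp ((-(ω * s) : ℝ) * I) * z s) 0 t := fun t => by
    have h1 : HasDerivAt (fun s : ℝ => (-(ω * s) : ℝ) * I) (((-ω : ℝ) : ℂ) * I) t := by
      have : HasDerivAt (fun s : ℝ => -(ω * s)) (-ω) t := by
        exact ((hasDerivAt_id t).const_mul ω).neg.congr_deriv (by rw [mul_one])
      exact this.ofReal_comp.mul_const I
    refine (h1.cexp.mul (h.hasDerivAt t)).congr_deriv ?_
    rw [hw]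
    push_cast
    ring
  have h1 := is_const_of_deriv_eq_zero (fun t => (hd t).differentiableAt)
    (fun t => (hd t).deriv) t 0
  simp only [mul_zero, neg_zero, ofReal_zero, zero_mul, exp_zero, one_mul] at h1
  rw [← h1, ← mul_assoc, ← exp_add]
  simp

end IsCentral

/-! ### Solutions of the equation of affine motion -/

section Solution

variable {κ : ℝ} {A : ℝ → M2}

lemma IsSolution.hasDerivAt_entry (hA : IsSolution κ A) (i j : Fin 2) (t : ℝ) :
    HasDerivAt (fun s => A s i j) (deriv (fun s => A s i j) t) t :=
  ((hA.contDiff i j).differentiable (by norm_num)).differentiableAt.hasDerivAt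

lemma IsSolution.hasDerivAt_deriv_entry (hA : IsSolution κ A) (i j : Fin 2) (t : ℝ) :
    HasDerivAt (deriv fun s => A s i j) (deriv (deriv fun s => A s i j) t) t := by
  have h : ContDiff ℝ (1 + 1) (fun s => A s i j) := by
    rw [one_add_one_eq_two]; exact hA.contDiff i j
  exact ((contDiff_succ_iff_deriv.1 h).2.2.differentiable one_ne_zero).differentiableAt.hasDerivAt

lemma hasDerivAt_complex_mk {f g : ℝ → ℝ} {f' g' t : ℝ} (hf : HasDerivAt f f' t)
    (hg : HasDerivAt g g' t) : HasDerivAt (fun s => (⟨f s, g s⟩ : ℂ)) ⟨f', g'⟩ t := by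
  simp only [Complex.mk_eq_add_mul_I]
  exact hf.ofReal_comp.add (hg.ofReal_comp.mul_const I)

/-- The two parts of a solution move in central force fields with opposite multipliers. -/
lemma IsSolution.exists_isCentral (hA : IsSolution κ A) :
    ∃ lam : ℝ → ℝ, Continuous lam ∧
      (∃ w, IsCentral (fun t => lam t - κ) (fun t => conf (A t)) w) ∧
      ∃ w, IsCentral (fun t => -lam t - κ) (fun t => anti (A t)) w := by
  obtain ⟨lam, hlam, heq⟩ := hA.exists_multiplier
  have e := fun t => And.intro (heq t 0 0) (And.intro (heq t 0 1)
    (And.intro (heq t 1 0) (heq t 1 1)))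
  simp only [cof, Matrix.adjugate_fin_two, Matrix.transpose_apply, Matrix.of_apply,
    Matrix.cons_val_zero, Matrix.cons_val_one, Matrix.cons_val'] at e
  refine ⟨lam, hlam, ⟨_, fun t => hasDerivAt_complex_mk
      (((hA.hasDerivAt_entry 0 0 t).add (hA.hasDerivAt_entry 1 1 t)).div_const 2)
      (((hA.hasDerivAt_entry 1 0 t).sub (hA.hasDerivAt_entry 0 1 t)).div_const 2),
      fun t => (hasDerivAt_complex_mk
      (((hA.hasDerivAt_deriv_entry 0 0 t).add (hA.hasDerivAt_deriv_entry 1 1 t)).div_const 2)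
      (((hA.hasDerivAt_deriv_entry 1 0 t).sub
        (hA.hasDerivAt_deriv_entry 0 1 t)).div_const 2)).congr_deriv ?_⟩,
    ⟨_, fun t => hasDerivAt_complex_mk
      (((hA.hasDerivAt_entry 0 0 t).sub (hA.hasDerivAt_entry 1 1 t)).div_const 2)
      (((hA.hasDerivAt_entry 0 1 t).add (hA.hasDerivAt_entry 1 0 t)).div_const 2),
      fun t => (hasDerivAt_complex_mk
      (((hA.hasDerivAt_deriv_entry 0 0 t).sub (hA.hasDerivAt_deriv_entry 1 1 t)).div_const 2)
      (((hA.hasDerivAt_deriv_entry 0 1 t).add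
        (hA.hasDerivAt_deriv_entry 1 0 t)).div_const 2)).congr_deriv ?_⟩⟩
  · obtain ⟨h1, h2, h3, h4⟩ := e t
    apply Complex.ext <;> simp only [conf, re_ofReal_mul, im_ofReal_mul] <;> linarith
  · obtain ⟨h1, h2, h3, h4⟩ := e t
    apply Complex.ext <;> simp only [anti, re_ofReal_mul, im_ofReal_mul] <;> linarith

/-- A solution with periodic norm is periodic up to rotating its two parts. -/
lemma IsSolution.exists_rotations (hA : IsSolution κ A) {T : ℝ}
    (hT : Function.Periodic (fun t => ‖A t‖) T) :
    ∃ u v : ℂ, ‖u‖ = 1 ∧ ‖v‖ = 1 ∧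
      ∀ t, conf (A (t + T)) = u * conf (A t) ∧ anti (A (t + T)) = v * anti (A t) := by
  obtain ⟨lam, hlam, ⟨w₁, h₁⟩, ⟨w₂, h₂⟩⟩ := hA.exists_isCentral
  have hc : ∀ t, ‖conf (A (t + T))‖ = ‖conf (A t)‖ := fun t =>
    norm_conf_eq (hA.det_eq_one _) (hA.det_eq_one _) (hT t)
  have ha : ∀ t, ‖anti (A (t + T))‖ = ‖anti (A t)‖ := fun t =>
    norm_anti_eq (hA.det_eq_one _) (hA.det_eq_one _) (hT t)
  -- Periodicity of `lam` comes from the conformal part, which never vanishes; the anticonformal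
  -- part may.
  have hq : ∀ t, lam (t + T) - κ = lam t - κ := fun t =>
    h₁.coeff_add hc (conf_ne_zero (hA.det_eq_one t))
  obtain ⟨u, hu, hu'⟩ := h₁.exists_rotation (hlam.sub continuous_const) hq hc
  obtain ⟨v, hv, hv'⟩ := h₂.exists_rotation (hlam.neg.sub continuous_const)
    (fun t => by linarith [hq t]) ha
  exact ⟨u, v, hu, hv, fun t => ⟨hu' t, hv' t⟩⟩

/-- The two parts of a rigid solution rotate uniformly. -/
lemma IsSolution.exists_frequencies (hA : IsSolution κ A) (hr : IsRigid A) :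
    ∃ ω₁ ω₂ : ℝ, ∀ t, conf (A t) = exp ((ω₁ * t : ℝ) * I) * conf (A 0) ∧
      anti (A t) = exp ((ω₂ * t : ℝ) * I) * anti (A 0) := by
  obtain ⟨lam, hlam, ⟨w₁, h₁⟩, ⟨w₂, h₂⟩⟩ := hA.exists_isCentral
  obtain ⟨c, hc⟩ := hr
  obtain ⟨ω₁, h1⟩ := h₁.exists_eq_exp fun t =>
    norm_conf_eq (hA.det_eq_one _) (hA.det_eq_one _) (by rw [hc, hc])
  obtain ⟨ω₂, h2⟩ := h₂.exists_eq_exp fun t =>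
    norm_anti_eq (hA.det_eq_one _) (hA.det_eq_one _) (by rw [hc, hc])
  exact ⟨ω₁, ω₂, fun t => ⟨h1 t, h2 t⟩⟩

lemma IsSolution.continuous_norm (hA : IsSolution κ A) : Continuous fun t => ‖A t‖ :=
  (continuous_matrix fun i j => (hA.contDiff i j).continuous).norm

end Solution

/-! ### Simultaneous approximation on the torus -/

lemma norm_exp_mul_I_sub_one_le (x : ℝ) : ‖exp (x * I) - 1‖ ≤ |x| := by
  rw [mul_comm]
  exact Real.norm_exp_I_mul_ofReal_sub_one_le

lemma exp_two_pi_mul_eq {x y : ℝ} {m : ℤ} (h : x = y + m) :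
    exp ((2 * Real.pi * x : ℝ) * I) = exp ((2 * Real.pi * y : ℝ) * I) := by
  rw [Complex.exp_eq_exp_iff_exists_int]
  refine ⟨m, ?_⟩
  rw [h]
  push_cast
  ring

lemma abs_sub_lt_of_floor_eq {N : ℕ} (hN : 1 ≤ N) {a b : ℝ} (ha : 0 ≤ a) (hb : 0 ≤ b)
    (h : ⌊N * a⌋₊ = ⌊N * b⌋₊) : |b - a| ≤ 1 / N := by
  have hN' : (0 : ℝ) < N := by exact_mod_cast hN
  have h1 := Nat.floor_le (mul_nonneg hN'.le ha)
  have h2 := Nat.lt_floor_add_one (N * a)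
  have h3 := Nat.floor_le (mul_nonneg hN'.le hb)
  have h4 := Nat.lt_floor_add_one (N * b)
  rw [h] at h1 h2
  rw [abs_le, le_div_iff₀ hN', ← neg_div, div_le_iff₀ hN']
  constructor <;> nlinarith

/-- Dirichlet's theorem on simultaneous approximation, for two rotations of the circle. -/
lemma exists_pow_near_one {u v : ℂ} (hu : ‖u‖ = 1) (hv : ‖v‖ = 1) {N : ℕ} (hN : 1 ≤ N) :
    ∃ ℓ : ℕ, 1 ≤ ℓ ∧ ℓ ≤ N ^ 2 ∧ ‖u ^ ℓ - 1‖ ≤ 2 * Real.pi / N ∧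
      ‖v ^ ℓ - 1‖ ≤ 2 * Real.pi / N := by
  have hN' : (0 : ℝ) < N := by exact_mod_cast hN
  have key : ∀ u : ℂ, ‖u‖ = 1 → ∃ x : ℝ, ∀ k k' : ℕ, k ≤ k' →
      ⌊N * Int.fract (k * x)⌋₊ = ⌊N * Int.fract (k' * x)⌋₊ →
      ‖u ^ (k' - k) - 1‖ ≤ 2 * Real.pi / N := fun u hu => by
    refine ⟨u.arg / (2 * Real.pi), fun k k' hk h => ?_⟩
    set x := u.arg / (2 * Real.pi) with hx
    have hux : u ^ (k' - k) = exp ((2 * Real.pi * (k' * x - k * x) : ℝ) * I) := by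
      conv_lhs => rw [← norm_mul_exp_arg_mul_I u, hu, ofReal_one, one_mul, ← Complex.exp_nat_mul]
      congr 1
      have : u.arg = 2 * Real.pi * x := by rw [hx]; field_simp
      rw [this]
      push_cast [Nat.cast_sub hk]
      ring
    rw [hux, exp_two_pi_mul_eq (y := Int.fract (k' * x) - Int.fract (k * x))
      (m := ⌊k' * x⌋ - ⌊k * x⌋) (by rw [Int.fract, Int.fract]; push_cast; ring)]
    refine (norm_exp_mul_I_sub_one_le _).trans ?_
    rw [abs_mul, abs_of_pos Real.two_pi_pos, div_eq_mul_one_div]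
    exact mul_le_mul_of_nonneg_left
      (abs_sub_lt_of_floor_eq hN (Int.fract_nonneg _) (Int.fract_nonneg _) h) Real.two_pi_pos.le
  obtain ⟨x, hx⟩ := key u hu
  obtain ⟨y, hy⟩ := key v hv
  have hbox : ∀ z : ℝ, ⌊N * Int.fract z⌋₊ ∈ Finset.range N := fun z => by
    rw [Finset.mem_range, Nat.floor_lt (mul_nonneg hN'.le (Int.fract_nonneg z))]
    nlinarith [Int.fract_lt_one z]
  -- Pigeonhole: `N ^ 2 + 1` exponents, starting from `0`, fall into `N ^ 2` boxes of side `1 / N`,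
  -- angles being measured in turns. Two exponents in one box differ by the required `ℓ`.
  obtain ⟨k, hk, k', hk', hne, heq⟩ := Finset.exists_ne_map_eq_of_card_lt_of_maps_to
    (s := Finset.range (N ^ 2 + 1)) (t := Finset.range N ×ˢ Finset.range N)
    (f := fun k : ℕ => (⌊N * Int.fract (k * x)⌋₊, ⌊N * Int.fract (k * y)⌋₊))
    (by simp [sq]) (fun k _ => by
      simpa only [Finset.coe_product, Set.mem_prod, Finset.mem_coe] using ⟨hbox _, hbox _⟩)
  rw [Finset.mem_range] at hk hk'
  rw [Prod.mk.injEq] at heq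
  wlog hlt : k < k' generalizing k k'
  · exact this k' hk' k hk hne.symm ⟨heq.1.symm, heq.2.symm⟩ (by omega)
  exact ⟨k' - k, by omega, by omega, hx k k' hlt.le heq.1, hy k k' hlt.le heq.2⟩

/-- A line of irrational slope is dense in the torus (Kronecker). -/
lemma exists_exp_near {ω₁ ω₂ : ℝ} (hirr : Irrational (ω₂ / ω₁)) (x y : ℝ) {δ : ℝ} (hδ : 0 < δ) :
    ∃ t : ℝ, exp ((ω₁ * t : ℝ) * I) = exp (x * I) ∧
      ‖exp ((ω₂ * t - y : ℝ) * I) - 1‖ ≤ δ := by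
  have hω : ω₁ ≠ 0 := by
    rintro rfl
    simp at hirr
  have hpi := Real.two_pi_pos
  -- The first angle is exactly `x` at the times `(x + 2πm) / ω₁`. The second is then near `y`
  -- modulo `2π` when some `m * (ω₂ / ω₁) + n` is near `(y - (ω₂ / ω₁) * x) / 2π`.
  have hd : Dense (AddSubgroup.closure {ω₂ / ω₁, 1} : Set ℝ) :=
    dense_addSubgroupClosure_pair_iff.2 (by rwa [div_one])
  obtain ⟨s, hs, hsδ⟩ := Metric.dense_iff.1 hd ((y - ω₂ / ω₁ * x) / (2 * Real.pi))
    (δ / (2 * Real.pi)) (by positivity)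
  obtain ⟨m, n, hmn⟩ := AddSubgroup.mem_closure_pair.1 hsδ
  simp only [zsmul_eq_mul, mul_one] at hmn
  refine ⟨(x + 2 * Real.pi * m) / ω₁, ?_, ?_⟩
  · rw [mul_div_cancel₀ _ hω, Complex.exp_eq_exp_iff_exists_int]
    exact ⟨m, by push_cast; ring⟩
  · rw [show ω₂ * ((x + 2 * Real.pi * m) / ω₁) - y =
        2 * Real.pi * ((ω₂ / ω₁ * x - y) / (2 * Real.pi) + m * (ω₂ / ω₁)) by field_simp; ring,
      exp_two_pi_mul_eq (y := (ω₂ / ω₁ * x - y) / (2 * Real.pi) + s) (m := -n)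
        (by rw [← hmn]; push_cast; ring)]
    refine (norm_exp_mul_I_sub_one_le _).trans ?_
    rw [Metric.mem_ball, Real.dist_eq, lt_div_iff₀ hpi] at hs
    rw [abs_mul, abs_of_pos hpi, mul_comm]
    refine le_trans (le_of_eq ?_) hs.le
    congr 2
    ring

/-! ### Recurrence and density -/

section Solution

variable {κ : ℝ} {A : ℝ → M2}

lemma IsSolution.exists_norm_sub_le (hA : IsSolution κ A) {T : ℝ}
    (hT : Function.Periodic (fun t => ‖A t‖) T) {N : ℕ} (hN : 1 ≤ N) :
    ∃ ℓ : ℕ, 1 ≤ ℓ ∧ ℓ ≤ N ^ 2 ∧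
      ∀ t : ℝ, ‖A (2 * (ℓ : ℝ) * T + t) - A t‖ ≤ 8 * Real.pi * ‖A t‖ / (N : ℝ) := by
  obtain ⟨u, v, hu, hv, huv⟩ := hA.exists_rotations (hT.nat_mul 2)
  obtain ⟨ℓ, h1, h2, hul, hvl⟩ := exists_pow_near_one hu hv hN
  have hpow : ∀ (k : ℕ) (t : ℝ), conf (A (2 * (k : ℝ) * T + t)) = u ^ k * conf (A t) ∧
      anti (A (2 * (k : ℝ) * T + t)) = v ^ k * anti (A t) := fun k t => by
    induction k with
    | zero => simp
    | succ k ih =>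
      have h := huv (2 * (k : ℝ) * T + t)
      rw [show 2 * (k : ℝ) * T + t + (2 : ℕ) * T = 2 * ((k + 1 : ℕ) : ℝ) * T + t by
        push_cast; ring, ih.1, ih.2] at h
      exact ⟨by rw [h.1]; ring, by rw [h.2]; ring⟩
  refine ⟨ℓ, h1, h2, fun t => ?_⟩
  have hpi := Real.pi_pos
  -- This already gives the bound with `2π` in place of `8π`.
  refine (norm_sub_le_of_mul (by positivity) (hpow ℓ t).1 (hpow ℓ t).2 hul hvl).trans ?_
  rw [div_mul_eq_mul_div]
  gcongr
  norm_num

lemma IsSolution.isRecurrent (hA : IsSolution κ A) {T : ℝ} (hT₀ : 0 < T)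
    (hT : Function.Periodic (fun t => ‖A t‖) T) : IsRecurrent A := by
  intro ε hε S
  obtain ⟨M, hM⟩ := (hT.compact_of_continuous hT₀.ne' hA.continuous_norm).bddAbove
  have hM' : ∀ t, ‖A t‖ ≤ M := fun t => hM ⟨t, rfl⟩
  -- The norm also has period `m * T > max S 0`; with it, every delay `2 * ℓ * (m * T)`, `ℓ ≥ 1`,
  -- exceeds `S`.
  obtain ⟨m, hm⟩ := exists_nat_gt (max S 0 / T)
  obtain ⟨N, hN⟩ := exists_nat_gt (8 * Real.pi * M / ε)
  have hpi := Real.pi_pos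
  have hM0 : 0 ≤ M := (norm_nonneg _).trans (hM' 0)
  have hN0 : (0 : ℝ) < N := lt_of_le_of_lt (by positivity) hN
  obtain ⟨ℓ, h1, -, hℓ⟩ := hA.exists_norm_sub_le (hT.nat_mul m)
    (show 1 ≤ N by exact_mod_cast hN0)
  refine ⟨2 * ℓ * (m * T), ?_, fun t => (hℓ t).trans_lt ?_⟩
  · rw [div_lt_iff₀ hT₀] at hm
    have h1' : (1 : ℝ) ≤ ℓ := by exact_mod_cast h1
    nlinarith [le_max_left S 0, le_max_right S 0]
  · rw [div_lt_iff₀ hε] at hN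
    rw [div_lt_iff₀ hN0]
    nlinarith [mul_le_mul_of_nonneg_left (hM' t) (by positivity : 0 ≤ 8 * Real.pi)]

/-- When `anti (A 0) = 0` the second frequency has no effect, hence the alternative in `h₂`. -/
lemma periodic_of_frequencies {ω₁ ω₂ : ℝ}
    (h : ∀ t, conf (A t) = exp ((ω₁ * t : ℝ) * I) * conf (A 0) ∧
      anti (A t) = exp ((ω₂ * t : ℝ) * I) * anti (A 0)) {P : ℝ}
    (h₁ : ∃ m : ℤ, ω₁ * P = m * (2 * Real.pi))
    (h₂ : anti (A 0) = 0 ∨ ∃ n : ℤ, ω₂ * P = n * (2 * Real.pi)) : Function.Periodic A P := by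
  have key : ∀ ω t : ℝ, (∃ m : ℤ, ω * P = m * (2 * Real.pi)) →
      exp ((ω * (t + P) : ℝ) * I) = exp ((ω * t : ℝ) * I) := fun ω t ⟨m, hm⟩ => by
    rw [Complex.exp_eq_exp_iff_exists_int]
    refine ⟨m, ?_⟩
    rw [mul_add, hm]
    push_cast
    ring
  intro t
  apply eq_of_conf_anti
  · rw [(h _).1, (h t).1, key _ _ h₁]
  · rcases h₂ with h₂ | h₂
    · rw [(h _).2, (h t).2, h₂, mul_zero, mul_zero]
    · rw [(h _).2, (h t).2, key _ _ h₂]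

lemma exists_eq_exp_mul {z z' : ℂ} (hz : z ≠ 0) (h : ‖z'‖ = ‖z‖) :
    ∃ x : ℝ, z' = exp (x * I) * z := by
  refine ⟨(z' / z).arg, ?_⟩
  have hn : ‖z' / z‖ = 1 := by rw [norm_div, h, div_self (norm_ne_zero_iff.2 hz)]
  have := norm_mul_exp_arg_mul_I (z' / z)
  rw [hn, ofReal_one, one_mul] at this
  rw [this, div_mul_cancel₀ _ hz]

/-- The two parts of a matrix on the sphere have the same moduli as those of `A 0`, so the matrix is
given by two angles relative to `A 0`, and Kronecker's theorem applies. -/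
lemma exists_norm_sub_lt_of_irrational {ω₁ ω₂ : ℝ}
    (h : ∀ t, conf (A t) = exp ((ω₁ * t : ℝ) * I) * conf (A 0) ∧
      anti (A t) = exp ((ω₂ * t : ℝ) * I) * anti (A 0))
    (hdet : (A 0).det = 1) (hne : anti (A 0) ≠ 0) (hirr : Irrational (ω₂ / ω₁)) {B : M2}
    (hB : B ∈ slSphere ‖A 0‖) {ε : ℝ} (hε : 0 < ε) : ∃ t : ℝ, ‖A t - B‖ < ε := by
  obtain ⟨x, hx⟩ := exists_eq_exp_mul (conf_ne_zero hdet) (norm_conf_eq hB.1 hdet hB.2)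
  obtain ⟨y, hy⟩ := exists_eq_exp_mul hne (norm_anti_eq hB.1 hdet hB.2)
  have hδ : 0 < ε / (‖B‖ + 1) := by positivity
  obtain ⟨t, ht₁, ht₂⟩ := exists_exp_near hirr x y hδ
  refine ⟨t, ?_⟩
  have hle : ‖A t - B‖ ≤ ε / (‖B‖ + 1) * ‖B‖ := by
    refine norm_sub_le_of_mul (u := 1) hδ.le ?_ ?_ (by simpa using hδ.le) ht₂
    · rw [(h t).1, hx, ht₁, one_mul]
    · rw [(h t).2, hy, ← mul_assoc, ← exp_add]
      congr 2
      push_cast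
      ring
  refine hle.trans_lt ?_
  rw [div_mul_eq_mul_div, div_lt_iff₀ (by positivity)]
  linarith

/-- A rigid solution is periodic or dense in a sphere. -/
lemma IsSolution.periodic_or_dense (hA : IsSolution κ A) (hr : IsRigid A) :
    (∃ P : ℝ, 0 < P ∧ Function.Periodic A P) ∨
      ∀ B ∈ slSphere ‖A 0‖, ∀ ε : ℝ, 0 < ε → ∃ t : ℝ, ‖A t - B‖ < ε := by
  obtain ⟨ω₁, ω₂, h⟩ := hA.exists_frequencies hr
  have hpi := Real.two_pi_pos
  have single : ∀ ω : ℝ, ∃ P : ℝ, 0 < P ∧ ∃ m : ℤ, ω * P = m * (2 * Real.pi) := fun ω => by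
    rcases eq_or_ne ω 0 with rfl | hω
    · exact ⟨1, one_pos, 0, by simp⟩
    · rcases hω.lt_or_gt with hneg | hpos
      · exact ⟨2 * Real.pi / -ω, div_pos hpi (by linarith), -1, by push_cast; field_simp⟩
      · exact ⟨2 * Real.pi / ω, div_pos hpi hpos, 1, by push_cast; field_simp⟩
  by_cases hne : anti (A 0) = 0
  · obtain ⟨P, hP, hm⟩ := single ω₁
    exact Or.inl ⟨P, hP, periodic_of_frequencies h hm (Or.inl hne)⟩
  by_cases hirr : Irrational (ω₂ / ω₁)
  · exact Or.inr fun B hB ε hε =>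
      exists_norm_sub_lt_of_irrational h (hA.det_eq_one 0) hne hirr hB hε
  left
  -- For `ω₁ = 0` the quotient `ω₂ / ω₁` is `0` by convention and says nothing about `ω₂`.
  rcases eq_or_ne ω₁ 0 with rfl | hω
  · obtain ⟨P, hP, hm⟩ := single ω₂
    exact ⟨P, hP, periodic_of_frequencies h ⟨0, by simp⟩ (Or.inr hm)⟩
  · obtain ⟨P, hP, m, hm⟩ := single ω₁
    obtain ⟨r, hr⟩ := not_not.1 hirr
    have hden : (r.den : ℝ) ≠ 0 := by exact_mod_cast r.den_nz
    have hω₂ : ω₂ * r.den = r.num * ω₁ := by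
      rw [Rat.cast_def, div_eq_div_iff hden hω] at hr
      exact hr.symm
    -- Since `ω₂ * r.den = r.num * ω₁`, in time `r.den * P` the two angles make `r.den * m` and
    -- `r.num * m` full turns.
    refine ⟨r.den * P, mul_pos (by exact_mod_cast r.den_pos) hP, periodic_of_frequencies h
      ⟨r.den * m, ?_⟩ (Or.inr ⟨r.num * m, ?_⟩)⟩
    · push_cast
      linear_combination (r.den : ℝ) * hm
    · push_cast
      linear_combination P * hω₂ + (r.num : ℝ) * hm

end Solution

end AffineMHD

theorem theorem11p7 (κ : ℝ) (hκ : 0 ≤ κ) (A : ℝ → AffineMHD.M2)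
    (hA : AffineMHD.IsSolution κ A) :
    (∀ T : ℝ, 0 < T → Function.Periodic (fun t : ℝ => ‖A t‖) T → ¬ AffineMHD.IsRigid A →
      (∀ N : ℕ, 1 ≤ N → ∃ ℓ : ℕ, 1 ≤ ℓ ∧ ℓ ≤ N ^ 2 ∧
        ∀ t : ℝ, ‖A (2 * (ℓ : ℝ) * T + t) - A t‖ ≤ 8 * Real.pi * ‖A t‖ / (N : ℝ)) ∧
      AffineMHD.IsRecurrent A) ∧
    (AffineMHD.IsRigid A →
      (∃ P : ℝ, 0 < P ∧ Function.Periodic A P) ∨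
      ((∀ t : ℝ, A t ∈ AffineMHD.slSphere ‖A 0‖) ∧
        ∀ B ∈ AffineMHD.slSphere ‖A 0‖, ∀ ε : ℝ, 0 < ε → ∃ t : ℝ, ‖A t - B‖ < ε)) := by
  refine ⟨fun T hT₀ hT _ => ⟨fun N hN => hA.exists_norm_sub_le hT hN, hA.isRecurrent hT₀ hT⟩,
    fun hr => (hA.periodic_or_dense hr).imp_right fun hd => ⟨fun t => ⟨hA.det_eq_one t, ?_⟩, hd⟩⟩
  obtain ⟨c, hc⟩ := hr
  rw [hc, hc]
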